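/- Let $G$ be a semi-Markovian graph (an acyclic directed graph with additional bidirected edges) on a finite vertex set $\mathbf V$, let $\mathbf X,\mathbf Y\subseteq\mathbf V$ be disjoint and let $W\in\mathbf V$. $\mathrm{An}$ and $\mathrm{De}$ denote the sets of ancestors and descendants of a set in a graph, and $\mathrm{Co}$ the set of vertices connected to it by paths along which edge directions are ignored; all three contain the set itself. For a set $\mathbf A$, $G_{\overline{\mathbf A}}$ is $G$ with all edges having an arrowhead at a vertex of $\mathbf A$ removed (including bidirected edges with an endpoint in $\mathbf A$), and $G[\mathbf A]$ is the induced subgraph. A semi-Markovian causal model with diagram $G$ has finitely many independent background variables, each an argument of at most two structural functions; the observed arguments of $f_V$ are the parents of $V$ in $G$, and $V\leftrightarrow V'$ is in $G$ if and only if $V\neq V'$ share a background variable. The observed variables take values in nonempty countable discrete spaces. $P(\mathbf V)$ is the distribution of the observed variables in the model, and $P_{\mathbf x}(\mathbf y)$ is the probability of $\mathbf Y=\mathbf y$ after the functions of the variables in $\mathbf X$ are replaced by the constants $\mathbf x$. It is identifiable from $P$ in $G$ if there is one functional that computes it from $P(\mathbf V)$, for all $\mathbf x,\mathbf y$, in every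 model with diagram $G$ (and the given value spaces) for which $P(\mathbf v)>0$ for all $\mathbf v$. Assume $G=G[\mathrm{An}(\mathbf Y)_G]$, and put $$\mathbf R=\mathrm{An}(W)_{G_{\overline{\mathbf X}}}\setminus \mathrm{De}(\mathbf X)_G,\qquad \mathbf T=\mathbf R\setminus\mathrm{Co}(\mathbf V\setminus\mathbf R)_{G_{\overline{W}}}.$$ Then $\mathbf T\cap\mathbf X=\emptyset$, and if $\mathbf Y\subseteq \mathrm{De}(\mathbf X)_G$ (in particular if $\mathbf X\ne\emptyset$ and $\mathbf Y$ is a singleton), then $\mathbf T\cap\mathbf Y=\emptyset$. Whenever $\mathbf T\cap\mathbf Y=\emptyset$, the set $\mathbf T$ can be removed from $G$ without changing $P_{\mathbf x}(\mathbf y)$, in the following sense, where $G'=G[\mathbf V\setminus\mathbf T]$: 1. for every semi-Markovian causal model with diagram $G$, observed distribution $P$ and effect $P_{\mathbf x}(\mathbf y)$, there is a semi-Markovian causal model with diagram $G'$ whose observed distribution is the marginal $P'=P(\mathbf V\setminus\mathbf T)$ and whose effect satisfies $P'_{\mathbf x}(\mathbf y)=P_{\mathbf x}(\mathbf y)$ for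 all $\mathbf x,\mathbf y$; 2. a functional $F$ computes the effect of $\mathbf X$ on $\mathbf Y$ from the observed distribution in all models with diagram $G'$ and positive observed distribution if and only if $P\mapsto F(P(\mathbf V\setminus\mathbf T))$ does so in all models with diagram $G$ and positive observed distribution; 3. the effect is identifiable from $P'$ in $G'$ if and only if it is identifiable from $P$ in $G$. -/

import Mathlib

open MeasureTheory
open scoped ENNReal

universe u

/-- A semi-Markovian graph (SMG) on the vertex set `V`: an acyclic directed graph `dir`
(`dir a b` is the edge `a → b`) together with bidirected edges `bi` (`bi.Adj a b` is `a ↔ b`). -/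
structure SMG (V : Type u) where
  dir : V → V → Prop
  bi : SimpleGraph V
  acyclic : ∀ v, ¬ Relation.TransGen dir v v

namespace SMG

variable {V : Type u}

/-- `An(S)_G`: the set `S` together with all its ancestors. -/
def An (G : SMG V) (S : Set V) : Set V :=
  {v | ∃ s ∈ S, Relation.ReflTransGen G.dir v s}

/-- `De(S)_G`: the set `S` together with all its descendants. -/
def De (G : SMG V) (S : Set V) : Set V :=
  {v | ∃ s ∈ S, Relation.ReflTransGen G.dir s v}

/-- The undirected graph obtained by ignoring the directionality of all (directed and bidirected)
edges. -/
def skeleton (G : SMG V) : SimpleGraph V :=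
  SimpleGraph.fromRel fun a b => G.dir a b ∨ G.bi.Adj a b

/-- `Co(S)_G`: all vertices connected to `S` by a path on which directions are ignored,
including `S`. -/
def Co (G : SMG V) (S : Set V) : Set V :=
  {v | ∃ s ∈ S, G.skeleton.Reachable s v}

/-- The graph `G` with all incoming edges of `X` removed; a bidirected edge is incoming at both of
its endpoints. -/
def removeIn (G : SMG V) (X : Set V) : SMG V where
  dir a b := G.dir a b ∧ b ∉ X
  bi :=
    { Adj := fun a b => G.bi.Adj a b ∧ a ∉ X ∧ b ∉ X
      symm := ⟨fun _ _ h => ⟨h.1.symm, h.2.2, h.2.1⟩⟩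
      loopless := ⟨fun _ h => h.1.ne rfl⟩ }
  acyclic v h := G.acyclic v (Relation.TransGen.mono (fun _ _ h => h.1) _ _ h)

/-- The induced subgraph `G[S]`. -/
def induce (G : SMG V) (S : Set V) : SMG S where
  dir a b := G.dir a b
  bi := G.bi.induce S
  acyclic v h := G.acyclic v (Relation.TransGen.lift Subtype.val (fun _ _ h => h) _ _ h)

theorem wellFounded_dir [Finite V] (G : SMG V) : WellFounded G.dir := by
  have : Std.Irrefl (Relation.TransGen G.dir) := ⟨G.acyclic⟩
  exact Subrelation.wf (r := Relation.TransGen G.dir) (fun h => Relation.TransGen.single h)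
    (Finite.wellFounded_of_trans_of_irrefl _)

end SMG

/-- A semi-Markovian causal model with observed variables `v : V` taking values in `Ω v` and with
causal diagram `G`. The background variables are indexed by the finite type `U`, are mutually
independent with laws `law`, and each of them is an argument of at most two of the functions `f`.
The observed arguments of `f v` are the parents of `v` in `G`, its unobserved arguments are the
members of `arg v`, and `a ↔ b` in `G` precisely when `a ≠ b` share a background variable. -/
structure SemiMarkovianModel {V : Type u} (G : SMG V) (Ω : V → Type u)
    [∀ v, MeasurableSpace (Ω v)] where
  U : Type u
  [fintypeU : Fintype U]
  Θ : U → Type u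
  [measurableSpaceΘ : ∀ i, MeasurableSpace (Θ i)]
  law : ∀ i, Measure (Θ i)
  [isProbabilityMeasure_law : ∀ i, IsProbabilityMeasure (law i)]
  arg : V → Set U
  arg_le_two : ∀ i, {v | i ∈ arg v}.encard ≤ 2
  bi_iff : ∀ a b, G.bi.Adj a b ↔ a ≠ b ∧ ∃ i, i ∈ arg a ∧ i ∈ arg b
  f : ∀ v, (∀ w, Ω w) → (∀ i, Θ i) → Ω v
  f_congr : ∀ v (ω ω' : ∀ w, Ω w) (θ θ' : ∀ i, Θ i),
    (∀ w, G.dir w v → ω w = ω' w) → (∀ i ∈ arg v, θ i = θ' i) → f v ω θ = f v ω' θ'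
  measurable_f : ∀ v, Measurable fun q : (∀ w, Ω w) × (∀ i, Θ i) => f v q.1 q.2

namespace SemiMarkovianModel

attribute [instance] fintypeU measurableSpaceΘ isProbabilityMeasure_law

variable {V : Type u} {G : SMG V} {Ω : V → Type u} [∀ v, MeasurableSpace (Ω v)]

section Solution

variable [Finite V] [∀ v, Nonempty (Ω v)]

open Classical in
/-- The values of the observed variables determined by the values `θ` of the background
variables, computed recursively along the acyclic graph. -/
noncomputable def solution (M : SemiMarkovianModel G Ω) (θ : ∀ i, M.Θ i) : ∀ v, Ω v :=
  G.wellFounded_dir.fix fun v ih =>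
    M.f v (fun w => if h : G.dir w v then ih w h else Classical.arbitrary (Ω w)) θ

theorem solution_eq (M : SemiMarkovianModel G Ω) (θ : ∀ i, M.Θ i) (v : V) :
    M.solution θ v = M.f v (M.solution θ) θ := by
  rw [solution, WellFounded.fix_eq]
  refine M.f_congr v _ _ _ _ (fun w hw => ?_) (fun _ _ => rfl)
  simp [hw]

theorem solution_unique (M : SemiMarkovianModel G Ω) (θ : ∀ i, M.Θ i) (ω : ∀ v, Ω v)
    (h : ∀ v, ω v = M.f v ω θ) : ω = M.solution θ := by
  funext v
  induction v using G.wellFounded_dir.induction with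
  | _ v ih =>
    rw [h v, M.solution_eq θ v]
    exact M.f_congr v _ _ _ _ ih (fun _ _ => rfl)

theorem measurable_solution (M : SemiMarkovianModel G Ω) : Measurable M.solution := by
  classical
  refine measurable_pi_iff.2 fun v => ?_
  induction v using G.wellFounded_dir.induction with
  | _ v ih =>
    have key : (fun θ => M.solution θ v) = fun θ => M.f v
        (fun w => if G.dir w v then M.solution θ w else Classical.arbitrary (Ω w)) θ := by
      funext θ
      rw [M.solution_eq θ v]
      refine M.f_congr v _ _ _ _ (fun w hw => ?_) (fun _ _ => rfl)
      simp [hw]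
    rw [key]
    refine (M.measurable_f v).comp (Measurable.prodMk (measurable_pi_iff.2 fun w => ?_)
      measurable_id)
    change Measurable fun θ => if G.dir w v then M.solution θ w else Classical.arbitrary (Ω w)
    by_cases hw : G.dir w v
    · simpa only [if_pos hw] using ih w hw
    · simpa only [if_neg hw] using measurable_const

/-- The joint distribution `P(v)` of the observed variables. -/
noncomputable def observed (M : SemiMarkovianModel G Ω) : Measure (∀ v, Ω v) :=
  (Measure.pi M.law).map M.solution

end Solution

open Classical in
/-- The submodel `M_x`: for each `v` in `X` the function `f v` is replaced by the constant
`x v`. Its causal diagram is `G` without the edges into `X`. Only the coordinates of `x` in `X`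
matter. -/
noncomputable def intervene (M : SemiMarkovianModel G Ω) (X : Set V) (x : ∀ v, Ω v) :
    SemiMarkovianModel (G.removeIn X) Ω where
  U := M.U
  Θ := M.Θ
  law := M.law
  arg v := {i | i ∈ M.arg v ∧ v ∉ X}
  arg_le_two i := (Set.encard_le_encard fun _ h => h.1).trans (M.arg_le_two i)
  bi_iff a b := by
    change (G.bi.Adj a b ∧ a ∉ X ∧ b ∉ X) ↔ _
    rw [M.bi_iff]
    constructor
    · rintro ⟨⟨hne, i, ha, hb⟩, haX, hbX⟩
      exact ⟨hne, i, ⟨ha, haX⟩, ⟨hb, hbX⟩⟩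
    · rintro ⟨hne, i, ⟨ha, haX⟩, ⟨hb, hbX⟩⟩
      exact ⟨⟨hne, i, ha, hb⟩, haX, hbX⟩
  f v ω θ := if v ∈ X then x v else M.f v ω θ
  f_congr v ω ω' θ θ' hω hθ := by
    by_cases hv : v ∈ X
    · simp [hv]
    · simp only [hv, if_false]
      exact M.f_congr v _ _ _ _ (fun w hw => hω w ⟨hw, hv⟩) (fun i hi => hθ i ⟨hi, hv⟩)
  measurable_f v := by
    by_cases hv : v ∈ X
    · simp [hv]
    · simpa [hv] using M.measurable_f v

/-- The causal effect `P_x(y)`: the probability in the submodel `M_x` that the variables in `Y`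
take the values prescribed by `y`. Only the coordinates of `x` in `X` and of `y` in `Y` matter. -/
noncomputable def effect [Finite V] [∀ v, Nonempty (Ω v)] (M : SemiMarkovianModel G Ω)
    (X Y : Set V) (x y : ∀ v, Ω v) : ℝ≥0∞ :=
  (M.intervene X x).observed {ω | ∀ v ∈ Y, ω v = y v}

end SemiMarkovianModel

section Identification

variable {V : Type u} [Finite V]

/-- The restriction of an assignment of values to the variables in `S`. -/
def restrictTo {Ω : V → Type u} (S : Set V) (ω : ∀ v, Ω v) : ∀ v : S, Ω v := fun v => ω v

/-- The marginal distribution `P(S)`. -/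
noncomputable def marginal {Ω : V → Type u} [∀ v, MeasurableSpace (Ω v)] (S : Set V)
    (P : Measure (∀ v, Ω v)) : Measure (∀ v : S, Ω v) :=
  P.map (restrictTo S)

/-- The functional `F` computes the causal effect `P_x(y)` from `P(V)` (for all values `x`, `y`) in
every causal model with causal diagram `G` whose observed distribution is positive. -/
def Identifies (G : SMG V) (Ω : V → Type u) [∀ v, MeasurableSpace (Ω v)] [∀ v, Nonempty (Ω v)]
    (X Y : Set V) (F : Measure (∀ v, Ω v) → (∀ v, Ω v) → (∀ v, Ω v) → ℝ≥0∞) : Prop :=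
  ∀ M : SemiMarkovianModel G Ω, (∀ ω, M.observed {ω} ≠ 0) →
    ∀ x y, F M.observed x y = M.effect X Y x y

/-- The causal effect of `X` on `Y` is identifiable from `P` in `G`. -/
def Identifiable (G : SMG V) (Ω : V → Type u) [∀ v, MeasurableSpace (Ω v)]
    [∀ v, Nonempty (Ω v)] (X Y : Set V) : Prop :=
  ∃ F, Identifies G Ω X Y F

end Identification

/-! Once `S`, the complement of `T`, is known to contain `W`, no edge leaves `S`, and every edge
entering `S` from outside, directed or bidirected, has its arrowhead at `W` (`attachedOnlyAt_Co`).
Membership of `W` uses that every vertex is an ancestor of `Y`, and `Y` lies in `S`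
(`mem_Co_removeIn_of_An_eq_univ`).

Thus the removed variables depend only on their own background variables and reach `S` only through
`W`. Handing those background variables to the function of `W` (`project`) gives a model on `G[S]`
with the marginal distribution and the same effect, since interventions inside `S` cannot reach the
removed variables. Conversely, a model on `G[S]` extends to `G` by independent noise outside `S`
(`extend`), with the same effect and with positivity preserved. The two constructions transport
functionals in both directions. -/

/-! ### Gluing and restricting assignments -/

/-- The assignment that agrees with `ω` on `S` and with `η` off `S`. -/
noncomputable def glue {V : Type u} {Ω : V → Type u} (S : Set V) (ω : ∀ v : S, Ω v)
    (η : ∀ v, Ω v) : ∀ v, Ω v :=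
  open Classical in fun v => if h : v ∈ S then ω ⟨v, h⟩ else η v

section Glue

variable {V : Type u} {Ω : V → Type u} {S : Set V}

theorem glue_of_mem (ω : ∀ v : S, Ω v) (η : ∀ v, Ω v) {v : V} (h : v ∈ S) :
    glue S ω η v = ω ⟨v, h⟩ := by
  simp [glue, h]

theorem glue_of_notMem (ω : ∀ v : S, Ω v) (η : ∀ v, Ω v) {v : V} (h : v ∉ S) :
    glue S ω η v = η v := by
  simp [glue, h]

theorem restrictTo_glue (ω : ∀ v : S, Ω v) (η : ∀ v, Ω v) : restrictTo S (glue S ω η) = ω := by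
  funext v
  exact glue_of_mem ω η v.2

theorem glue_restrictTo (ω η : ∀ v, Ω v) (h : ∀ v ∉ S, ω v = η v) :
    glue S (restrictTo S ω) η = ω := by
  funext v
  by_cases hv : v ∈ S
  · rw [glue_of_mem _ _ hv, restrictTo]
  · rw [glue_of_notMem _ _ hv, h v hv]

theorem measurable_restrictTo [∀ v, MeasurableSpace (Ω v)] :
    Measurable (restrictTo (Ω := Ω) S) :=
  measurable_pi_iff.2 fun v => measurable_pi_apply (v : V)

theorem measurable_glue [∀ v, MeasurableSpace (Ω v)] :
    Measurable fun q : (∀ v : S, Ω v) × (∀ v, Ω v) => glue S q.1 q.2 := by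
  refine measurable_pi_iff.2 fun v => ?_
  by_cases hv : v ∈ S
  · simp only [glue_of_mem _ _ hv]
    exact (measurable_pi_apply (⟨v, hv⟩ : S)).comp measurable_fst
  · simp only [glue_of_notMem _ _ hv]
    exact (measurable_pi_apply v).comp measurable_snd

theorem measurableSet_cylinder [Finite V] [∀ v, MeasurableSpace (Ω v)]
    [∀ v, MeasurableSingletonClass (Ω v)] (Y : Set V) (y : ∀ v, Ω v) :
    MeasurableSet {ω : ∀ v, Ω v | ∀ v ∈ Y, ω v = y v} := by
  simp only [Set.ofPred_forall]
  exact MeasurableSet.iInter fun v => MeasurableSet.iInter fun _ =>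
    (measurable_pi_apply v) (measurableSet_singleton (y v))

end Glue

/-! ### Graph structure around `W` -/

namespace SMG

variable {V : Type u}

/-- The vertices outside `S` have no parents in `S`, and every edge between them and `S`
has an arrowhead at `W`. -/
structure AttachedOnlyAt (G : SMG V) (S : Set V) (W : V) : Prop where
  parent : ∀ {a b}, G.dir a b → b ∉ S → a ∉ S
  child : ∀ {a b}, G.dir a b → a ∉ S → b ∈ S → b = W
  bi : ∀ {a b}, G.bi.Adj a b → a ∉ S → b ∈ S → b = W

theorem subset_Co (G : SMG V) (A : Set V) : A ⊆ G.Co A :=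
  fun v hv => ⟨v, hv, .refl v⟩

theorem subset_De (G : SMG V) (A : Set V) : A ⊆ G.De A :=
  fun v hv => ⟨v, hv, .refl⟩

theorem mem_Co_of_adj {G : SMG V} {A : Set V} {a b : V} (h : G.skeleton.Adj a b)
    (ha : a ∈ G.Co A) : b ∈ G.Co A := by
  obtain ⟨s, hs, hsa⟩ := ha
  exact ⟨s, hs, hsa.trans h.reachable⟩

theorem skeleton_adj_of_dir {G : SMG V} {a b : V} (h : G.dir a b) : G.skeleton.Adj a b := by
  refine (SimpleGraph.fromRel_adj _ _ _).2 ⟨?_, .inl (.inl h)⟩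
  rintro rfl
  exact G.acyclic a (.single h)

theorem skeleton_adj_of_bi {G : SMG V} {a b : V} (h : G.bi.Adj a b) : G.skeleton.Adj a b :=
  (SimpleGraph.fromRel_adj _ _ _).2 ⟨h.ne, .inl (.inr h)⟩

/-- An edge between a union of components of the cut graph and its complement must have been cut, so
it has an arrowhead at `W`; as `W` is inside, that arrowhead is at the inner endpoint. -/
theorem attachedOnlyAt_Co {G : SMG V} {W : V} {A : Set V} (hW : W ∈ (G.removeIn {W}).Co A) :
    G.AttachedOnlyAt ((G.removeIn {W}).Co A) W where
  parent {a b} h hb ha := hb <| mem_Co_of_adj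
    (skeleton_adj_of_dir (G := G.removeIn {W}) ⟨h, by rintro rfl; exact hb hW⟩) ha
  child {a b} h ha hb := by
    by_contra hbW
    exact ha <| mem_Co_of_adj (skeleton_adj_of_dir (G := G.removeIn {W}) ⟨h, hbW⟩).symm hb
  bi {a b} h ha hb := by
    by_contra hbW
    refine ha <| mem_Co_of_adj (skeleton_adj_of_bi (G := G.removeIn {W}) ⟨h, ?_, hbW⟩).symm hb
    rintro rfl
    exact ha hW

/-- If `W` were outside, a directed path from `W` to `Y` could never enter the component set: each
of its edges either survives the cut or ends at `W`. -/
theorem mem_Co_removeIn_of_An_eq_univ {G : SMG V} {W : V} {A Y : Set V} (hG : G.An Y = Set.univ)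
    (hY : Y ⊆ (G.removeIn {W}).Co A) : W ∈ (G.removeIn {W}).Co A := by
  by_contra hW
  obtain ⟨y, hy, hWy⟩ : W ∈ G.An Y := hG ▸ Set.mem_univ W
  suffices y ∉ (G.removeIn {W}).Co A from this (hY hy)
  clear hy
  induction hWy with
  | refl => exact hW
  | @tail b c hWb hbc ih =>
    intro hc
    refine ih (mem_Co_of_adj (skeleton_adj_of_dir (G := G.removeIn {W}) ⟨hbc, ?_⟩).symm hc)
    rintro rfl
    exact hW hc

end SMG

/-! ### Projection: from `G` to `G[S]` -/

namespace SemiMarkovianModel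

section Project

variable {V : Type u} {G : SMG V} {Ω : V → Type u} [∀ v, MeasurableSpace (Ω v)]
  {S : Set V} {W : V}

theorem eq_of_arg_of_notMem (M : SemiMarkovianModel G Ω) (hS : G.AttachedOnlyAt S W) {i : M.U}
    {s t : V} (hs : s ∈ S) (ht : t ∉ S) (his : i ∈ M.arg s) (hit : i ∈ M.arg t) : s = W :=
  hS.bi ((M.bi_iff t s).2 ⟨by rintro rfl; exact ht hs, i, hit, his⟩) ht hs

variable [Finite V] [∀ v, Nonempty (Ω v)]

/-- The complement of `S` is closed under parents. This makes the enlarged argument set of `W` in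
`project` sufficient. -/
theorem solution_congr_of_notMem (M : SemiMarkovianModel G Ω) (hS : G.AttachedOnlyAt S W)
    {θ θ' : ∀ i, M.Θ i} (h : ∀ t ∉ S, ∀ i ∈ M.arg t, θ i = θ' i) :
    ∀ t ∉ S, M.solution θ t = M.solution θ' t := by
  intro t
  induction t using G.wellFounded_dir.induction with
  | _ t ih =>
    intro ht
    rw [M.solution_eq, M.solution_eq θ']
    exact M.f_congr _ _ _ _ _ (fun w hw => ih w hw (hS.parent hw ht)) (h t ht)

theorem solution_intervene_of_notMem (M : SemiMarkovianModel G Ω) (hS : G.AttachedOnlyAt S W)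
    {X : Set V} (hX : X ⊆ S) (x : ∀ v, Ω v) (θ : ∀ i, M.Θ i) :
    ∀ t ∉ S, (M.intervene X x).solution θ t = M.solution θ t := by
  intro t
  induction t using G.wellFounded_dir.induction with
  | _ t ih =>
    intro ht
    refine ((M.intervene X x).solution_eq θ t).trans
      ((if_neg fun h => ht (hX h)).trans (.trans ?_ (M.solution_eq θ t).symm))
    exact M.f_congr _ _ _ _ _ (fun w hw => ih w hw (hS.parent hw ht)) fun _ _ => rfl

/-- The model in which the variables outside `S` have become unobserved: their background
variables are arguments of the function of `W`. -/
noncomputable def project (M : SemiMarkovianModel G Ω) (hS : G.AttachedOnlyAt S W) :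
    SemiMarkovianModel (G.induce S) (fun v : S => Ω v) where
  U := M.U
  Θ := M.Θ
  law := M.law
  arg s := {i | i ∈ M.arg s ∨ (s : V) = W ∧ ∃ t ∉ S, i ∈ M.arg t}
  arg_le_two i := by
    -- A background variable of an outside vertex can be shared inside `S` only with `W`, so after
    -- the projection `W` is its only possible user; all others keep their old users.
    by_cases hi : ∃ t ∉ S, i ∈ M.arg t
    · obtain ⟨t, ht, hit⟩ := hi
      refine (Set.encard_le_one_iff.2 fun a b ha hb => ?_).trans one_le_two
      have key : ∀ c : S, (i ∈ M.arg c ∨ (c : V) = W ∧ ∃ t ∉ S, i ∈ M.arg t) → (c : V) = W :=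
        fun c hc => hc.elim (fun h => M.eq_of_arg_of_notMem hS c.2 ht h hit) And.left
      exact Subtype.ext ((key a ha).trans (key b hb).symm)
    · simp only [Set.mem_ofPred_eq, hi, and_false, or_false]
      rw [← Subtype.val_injective.encard_image]
      exact (Set.encard_le_encard (Set.image_subset_iff.2 fun _ h => h)).trans (M.arg_le_two i)
  bi_iff a b := by
    change G.bi.Adj a b ↔ _
    rw [M.bi_iff, Ne, Subtype.coe_inj]
    refine and_congr_right fun hab => ⟨fun ⟨i, ha, hb⟩ => ⟨i, .inl ha, .inl hb⟩, ?_⟩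
    rintro ⟨i, ha | ⟨ha, t, ht, hit⟩, hb | ⟨hb, t', ht', hit'⟩⟩
    · exact ⟨i, ha, hb⟩
    · exact absurd (Subtype.ext ((M.eq_of_arg_of_notMem hS a.2 ht' ha hit').trans hb.symm)) hab
    · exact absurd (Subtype.ext (ha.trans (M.eq_of_arg_of_notMem hS b.2 ht hb hit).symm)) hab
    · exact absurd (Subtype.ext (ha.trans hb.symm)) hab
  f s ω θ := M.f s (glue S ω (M.solution θ)) θ
  f_congr s ω ω' θ θ' hω hθ := by
    refine M.f_congr s _ _ _ _ (fun w hw => ?_) fun i hi => hθ i (.inl hi)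
    by_cases hwS : w ∈ S
    · rw [glue_of_mem _ _ hwS, glue_of_mem _ _ hwS]
      exact hω ⟨w, hwS⟩ hw
    · rw [glue_of_notMem _ _ hwS, glue_of_notMem _ _ hwS]
      -- An outside parent `w` of `s` forces `s = W`, whose arguments include all the outside
      -- background variables.
      exact M.solution_congr_of_notMem hS
        (fun t ht i hi => hθ i (.inr ⟨hS.child hw hwS s.2, t, ht, hi⟩)) w hwS
  measurable_f s := (M.measurable_f s).comp <| Measurable.prodMk
    (measurable_glue.comp (measurable_fst.prodMk (M.measurable_solution.comp measurable_snd)))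
    measurable_snd

theorem solution_project (M : SemiMarkovianModel G Ω) (hS : G.AttachedOnlyAt S W)
    (θ : ∀ i, M.Θ i) : (M.project hS).solution θ = restrictTo S (M.solution θ) := by
  refine ((M.project hS).solution_unique θ _ fun s => ?_).symm
  change M.solution θ s = M.f s (glue S _ (M.solution θ)) θ
  rw [glue_restrictTo _ _ fun _ _ => rfl, ← M.solution_eq]

/-- The projection fills in the outside values of the model without intervention; this is harmless
because intervening within `S` does not change them. -/
theorem solution_intervene_project (M : SemiMarkovianModel G Ω) (hS : G.AttachedOnlyAt S W)
    {X : Set V} (hX : X ⊆ S) (x : ∀ v, Ω v) (θ : ∀ i, M.Θ i) :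
    ((M.project hS).intervene (Subtype.val ⁻¹' X) (restrictTo S x)).solution θ
      = restrictTo S ((M.intervene X x).solution θ) := by
  refine (((M.project hS).intervene (Subtype.val ⁻¹' X) (restrictTo S x)).solution_unique θ _
    fun s => ?_).symm
  refine ((M.intervene X x).solution_eq θ s).trans ?_
  by_cases hs : (s : V) ∈ X
  · exact (if_pos hs).trans (if_pos (α := Ω s) hs).symm
  · refine (if_neg hs).trans (.trans ?_ (if_neg (α := Ω s) hs).symm)
    exact congrArg (fun ω => M.f s ω θ)
      (glue_restrictTo _ _ (M.solution_intervene_of_notMem hS hX x θ)).symm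

theorem observed_project (M : SemiMarkovianModel G Ω) (hS : G.AttachedOnlyAt S W) :
    (M.project hS).observed = marginal S M.observed := by
  rw [marginal, observed, observed, Measure.map_map measurable_restrictTo M.measurable_solution]
  exact congrArg (fun g => (Measure.pi M.law).map g) (funext (M.solution_project hS))

variable [∀ v, MeasurableSingletonClass (Ω v)]

theorem effect_eq (M : SemiMarkovianModel G Ω) (X Y : Set V) (x y : ∀ v, Ω v) :
    M.effect X Y x y
      = Measure.pi M.law {θ | ∀ v ∈ Y, (M.intervene X x).solution θ v = y v} :=
  Measure.map_apply (M.intervene X x).measurable_solution (measurableSet_cylinder Y y)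

theorem effect_project (M : SemiMarkovianModel G Ω) (hS : G.AttachedOnlyAt S W)
    {X Y : Set V} (hX : X ⊆ S) (hY : Y ⊆ S) (x y : ∀ v, Ω v) :
    (M.project hS).effect (Subtype.val ⁻¹' X) (Subtype.val ⁻¹' Y) (restrictTo S x)
      (restrictTo S y) = M.effect X Y x y := by
  rw [effect_eq, effect_eq]
  refine congrArg (Measure.pi M.law) (Set.ext fun θ => ?_)
  change (∀ v : S, (v : V) ∈ Y → ((M.project hS).intervene _ _).solution θ v = y v) ↔
    ∀ v ∈ Y, (M.intervene X x).solution θ v = y v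
  rw [M.solution_intervene_project hS hX x θ]
  exact ⟨fun h v hv => h ⟨v, hY hv⟩ hv, fun h v hv => h v hv⟩

end Project

instance isProbabilityMeasure_observed {V : Type u} {G : SMG V} {Ω : V → Type u}
    [∀ v, MeasurableSpace (Ω v)] [Finite V] [∀ v, Nonempty (Ω v)] (M : SemiMarkovianModel G Ω) :
    IsProbabilityMeasure M.observed :=
  Measure.isProbabilityMeasure_map M.measurable_solution.aemeasurable

instance measurableSpaceSumElim {ι ι' : Type*} (A : ι → Type u) (B : ι' → Type u)
    [hA : ∀ a, MeasurableSpace (A a)] [hB : ∀ b, MeasurableSpace (B b)] (i : ι ⊕ ι') :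
    MeasurableSpace (Sum.elim A B i) :=
  i.rec hA hB

/-! ### Extension: from `G[S]` to `G` -/

section Extend

variable {V : Type u} {G : SMG V} {Ω : V → Type u} [∀ v, MeasurableSpace (Ω v)]
  [Finite V] {S : Set V}

/-- The extension of a model with diagram `G[S]` to one with diagram `G`, in which the variables
outside `S` are independent of everything else and `v` is distributed according to `ν v`. -/
noncomputable def extend (M : SemiMarkovianModel (G.induce S) (fun v : S => Ω v))
    (ν : ∀ v, Measure (Ω v)) [∀ v, IsProbabilityMeasure (ν v)] : SemiMarkovianModel G Ω where
  -- For `v` outside `S`, the pair `(v, v)` carries the value of `v`. Off-diagonal pairs are never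
  -- read: they are declared as arguments only to create the bidirected edges with an endpoint
  -- outside `S`.
  U := M.U ⊕ V × V
  fintypeU := Fintype.ofFinite _
  Θ := Sum.elim M.Θ fun e => Ω e.1
  measurableSpaceΘ := measurableSpaceSumElim _ _
  law i := i.rec M.law fun e => ν e.1
  isProbabilityMeasure_law i := i.rec M.isProbabilityMeasure_law fun e =>
    inferInstanceAs (IsProbabilityMeasure (ν e.1))
  arg v := {i | Sum.elim (fun j => ∃ h : v ∈ S, j ∈ M.arg ⟨v, h⟩)
    (fun e => (v = e.1 ∨ v = e.2) ∧ (e.1 = e.2 ∨ G.bi.Adj e.1 e.2) ∧ (e.1 ∉ S ∨ e.2 ∉ S)) i}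
  arg_le_two i := by
    rcases i with j | e
    · refine le_trans (Set.encard_le_encard (t := Subtype.val '' {v : S | j ∈ M.arg v}) ?_)
        ((Set.encard_image_le _ _).trans (M.arg_le_two j))
      rintro v ⟨h, hv⟩
      exact ⟨⟨v, h⟩, hv, rfl⟩
    · exact (Set.encard_le_encard (t := {e.1, e.2}) fun v hv => hv.1).trans
        ((Set.encard_insert_le _ _).trans (by rw [Set.encard_singleton, one_add_one_eq_two]))
  bi_iff a b := by
    constructor
    · intro h
      refine ⟨h.ne, ?_⟩
      by_cases hab : a ∈ S ∧ b ∈ S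
      · obtain ⟨-, j, hja, hjb⟩ := (M.bi_iff ⟨a, hab.1⟩ ⟨b, hab.2⟩).1 h
        exact ⟨.inl j, ⟨hab.1, hja⟩, ⟨hab.2, hjb⟩⟩
      · have hab' := not_and_or.1 hab
        exact ⟨.inr (a, b), ⟨.inl rfl, .inr h, hab'⟩, ⟨.inr rfl, .inr h, hab'⟩⟩
    · rintro ⟨hne, j | ⟨c, d⟩, ha, hb⟩
      · obtain ⟨haS, ha⟩ := ha
        obtain ⟨hbS, hb⟩ := hb
        exact (M.bi_iff ⟨a, haS⟩ ⟨b, hbS⟩).2 ⟨fun h => hne (congrArg Subtype.val h), j, ha, hb⟩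
      · obtain ⟨ha, hcd, -⟩ := ha
        obtain ⟨hb, -, -⟩ := hb
        dsimp only at ha hb hcd
        rcases ha with rfl | rfl <;> rcases hb with rfl | rfl
        · exact absurd rfl hne
        · exact hcd.resolve_left hne
        · exact (hcd.resolve_left hne.symm).symm
        · exact absurd rfl hne
  f v ω θ := glue S (fun s => M.f s (restrictTo S ω) fun j => θ (.inl j))
    (fun v => θ (.inr (v, v))) v
  f_congr v ω ω' θ θ' hω hθ := by
    by_cases hv : v ∈ S
    · refine (glue_of_mem _ _ hv).trans (.trans ?_ (glue_of_mem _ _ hv).symm)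
      exact M.f_congr _ _ _ _ _ (fun w hw => hω w hw) fun j hj => hθ (.inl j) ⟨hv, hj⟩
    · refine (glue_of_notMem _ _ hv).trans (.trans ?_ (glue_of_notMem _ _ hv).symm)
      exact hθ (.inr (v, v)) ⟨.inl rfl, .inl rfl, .inl hv⟩
  measurable_f v := by
    refine (measurable_pi_apply v).comp ((measurable_glue (S := S)).comp
      (Measurable.prodMk
        (f := fun (q : (∀ w, Ω w) × ∀ i, Sum.elim M.Θ (fun e : V × V => Ω e.1) i) s =>
          M.f s (restrictTo S q.1) fun j => q.2 (.inl j))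
        (g := fun (q : (∀ w, Ω w) × ∀ i, Sum.elim M.Θ (fun e : V × V => Ω e.1) i) v =>
          q.2 (.inr (v, v)))
        (measurable_pi_iff.2 fun s => ?_) (measurable_pi_iff.2 fun v => ?_)))
    · refine (M.measurable_f s).comp (Measurable.prodMk
        (measurable_restrictTo.comp measurable_fst) (measurable_pi_iff.2 fun j => ?_))
      exact (measurable_pi_apply (Sum.inl j)).comp measurable_snd
    · exact (measurable_pi_apply (Sum.inr (v, v))).comp measurable_snd

variable (M : SemiMarkovianModel (G.induce S) (fun v : S => Ω v))
  (ν : ∀ v, Measure (Ω v)) [∀ v, IsProbabilityMeasure (ν v)]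

/-- The values of the background variables of `M.extend ν`, split into those of `M` and the
additional ones. -/
def splitBackground (θ : ∀ i, (M.extend ν).Θ i) : (∀ j, M.Θ j) × (∀ e : V × V, Ω e.1) :=
  (fun j => θ (Sum.inl j : M.U ⊕ V × V), fun e => θ (Sum.inr e : M.U ⊕ V × V))

theorem extend_f_of_mem {v : V} (hv : v ∈ S) (ω : ∀ v, Ω v) (θ : ∀ i, (M.extend ν).Θ i) :
    (M.extend ν).f v ω θ = M.f ⟨v, hv⟩ (restrictTo S ω) (M.splitBackground ν θ).1 :=
  glue_of_mem (fun s => M.f s (restrictTo S ω) (M.splitBackground ν θ).1)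
    (fun v => (M.splitBackground ν θ).2 (v, v)) hv

theorem extend_f_of_notMem {v : V} (hv : v ∉ S) (ω : ∀ v, Ω v) (θ : ∀ i, (M.extend ν).Θ i) :
    (M.extend ν).f v ω θ = (M.splitBackground ν θ).2 (v, v) :=
  glue_of_notMem (fun s => M.f s (restrictTo S ω) (M.splitBackground ν θ).1)
    (fun v => (M.splitBackground ν θ).2 (v, v)) hv

theorem measurePreserving_splitBackground [Fintype V] :
    MeasurePreserving (M.splitBackground ν) (Measure.pi (M.extend ν).law)
      ((Measure.pi M.law).prod (Measure.pi fun e : V × V => ν e.1)) := by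
  have h := @measurePreserving_sumPiEquivProdPi M.U (V × V) _ _
    (M.extend ν).Θ (M.extend ν).measurableSpaceΘ (M.extend ν).law
    (fun i => by have := (M.extend ν).isProbabilityMeasure_law i; infer_instance)
  -- `extend` takes its `Fintype` structure from `Fintype.ofFinite`, so the product measures match
  -- only after identifying the two structures.
  have : (instFintypeSum M.U (V × V)) = (M.extend ν).fintypeU := Subsingleton.elim _ _
  rw [this] at h
  exact h

variable [∀ v, Nonempty (Ω v)]

theorem solution_extend (θ : ∀ i, (M.extend ν).Θ i) :
    (M.extend ν).solution θ = glue S (M.solution (M.splitBackground ν θ).1)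
      fun v => (M.splitBackground ν θ).2 (v, v) := by
  refine ((M.extend ν).solution_unique θ _ fun v => ?_).symm
  by_cases hv : v ∈ S
  · rw [extend_f_of_mem _ _ hv, restrictTo_glue, glue_of_mem _ _ hv]
    exact M.solution_eq _ _
  · rw [extend_f_of_notMem _ _ hv, glue_of_notMem _ _ hv]

theorem restrictTo_solution_intervene_extend (X : Set V) (x : ∀ v, Ω v)
    (θ : ∀ i, (M.extend ν).Θ i) :
    restrictTo S (((M.extend ν).intervene X x).solution θ)
      = (M.intervene (Subtype.val ⁻¹' X) (restrictTo S x)).solution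
        (M.splitBackground ν θ).1 := by
  refine (M.intervene (Subtype.val ⁻¹' X) (restrictTo S x)).solution_unique _ _ fun s => ?_
  refine (((M.extend ν).intervene X x).solution_eq θ s).trans ?_
  by_cases hs : (s : V) ∈ X
  · exact (if_pos hs).trans (if_pos (α := Ω s) hs).symm
  · refine (if_neg hs).trans (.trans ?_ (if_neg (α := Ω s) hs).symm)
    exact M.extend_f_of_mem ν s.2 _ θ

/-- The right-hand side involves `M` only through `M.observed`; this is what turns a functional for
`G` into one for `G[S]`. -/
theorem observed_extend [Fintype V] :
    (M.extend ν).observed = (M.observed.prod (Measure.pi fun e : V × V => ν e.1)).map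
      fun q => glue S q.1 fun v => q.2 (v, v) := by
  have hd : Measurable fun (η : ∀ e : V × V, Ω e.1) (v : V) => η (v, v) :=
    measurable_pi_iff.2 fun v => measurable_pi_apply (v, v)
  have hg : Measurable fun q : (∀ v : S, Ω v) × (∀ e : V × V, Ω e.1) =>
      glue S q.1 fun v => q.2 (v, v) :=
    measurable_glue.comp (measurable_fst.prodMk (hd.comp measurable_snd))
  have hp := (M.measurable_solution.prodMap
    (measurable_id (α := ∀ e : V × V, Ω e.1)))
  have h1 : M.observed.prod (Measure.pi fun e : V × V => ν e.1)
      = ((Measure.pi M.law).prod (Measure.pi fun e : V × V => ν e.1)).map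
        (Prod.map M.solution id) := by
    rw [← Measure.map_prod_map _ _ M.measurable_solution measurable_id, Measure.map_id]
    rfl
  rw [h1, ← (M.measurePreserving_splitBackground ν).map_eq, Measure.map_map hp
    (M.measurePreserving_splitBackground ν).measurable, Measure.map_map hg
    (hp.comp (M.measurePreserving_splitBackground ν).measurable)]
  exact congrArg (fun g => (Measure.pi (M.extend ν).law).map g) (funext (M.solution_extend ν))

theorem marginal_observed_extend : marginal S (M.extend ν).observed = M.observed := by
  have := Fintype.ofFinite V
  have h : restrictTo S ∘ (M.extend ν).solution
      = M.solution ∘ Prod.fst ∘ M.splitBackground ν := by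
    funext θ
    rw [Function.comp_apply, solution_extend, restrictTo_glue]
    rfl
  rw [marginal, observed, Measure.map_map measurable_restrictTo (measurable_solution _), h,
    ← Measure.map_map M.measurable_solution
      (measurable_fst.comp (M.measurePreserving_splitBackground ν).measurable),
    ← Measure.map_map measurable_fst (M.measurePreserving_splitBackground ν).measurable,
    (M.measurePreserving_splitBackground ν).map_eq, Measure.map_fst_prod, measure_univ, one_smul, observed]

variable [∀ v, MeasurableSingletonClass (Ω v)]

/-- Inside `S` the extended functions read only `S`-values and the original background variables,
whose law is the first marginal of the product. -/
theorem effect_extend {X Y : Set V} (hY : Y ⊆ S) (x y : ∀ v, Ω v) :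
    (M.extend ν).effect X Y x y = M.effect (Subtype.val ⁻¹' X) (Subtype.val ⁻¹' Y)
      (restrictTo S x) (restrictTo S y) := by
  have := Fintype.ofFinite V
  have hm : MeasurePreserving (fun θ => (M.splitBackground ν θ).1)
      (Measure.pi (M.extend ν).law) (Measure.pi M.law) :=
    measurePreserving_fst.comp (M.measurePreserving_splitBackground ν)
  rw [effect_eq, effect_eq, ← hm.measure_preimage]
  · refine congrArg (Measure.pi (M.extend ν).law) (Set.ext fun θ => ?_)
    simp only [Set.mem_preimage, Set.mem_ofPred_eq,
      ← M.restrictTo_solution_intervene_extend ν X x θ]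
    exact ⟨fun h v hv => h v hv, fun h v hv => h ⟨v, hY hv⟩ hv⟩
  · exact ((M.intervene _ _).measurable_solution
      (measurableSet_cylinder _ (restrictTo S y))).nullMeasurableSet

theorem observed_extend_singleton_ne_zero (hν : ∀ v (a : Ω v), ν v {a} ≠ 0)
    (hM : ∀ ω, M.observed {ω} ≠ 0) (ω : ∀ v, Ω v) : (M.extend ν).observed {ω} ≠ 0 := by
  have := Fintype.ofFinite V
  rw [observed_extend, Measure.map_apply _ (measurableSet_singleton ω)]
  -- The preimage of a point contains a one-point rectangle, whose mass is a finite product of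
  -- nonzero factors.
  · have hsub : ({restrictTo S ω} : Set (∀ v : S, Ω v)) ×ˢ
        ({fun e : V × V => ω e.1} : Set (∀ e : V × V, Ω e.1)) ⊆
        (fun q => glue S q.1 fun v => q.2 (v, v)) ⁻¹' {ω} := by
      rintro ⟨a, b⟩ ⟨rfl, rfl⟩
      exact glue_restrictTo _ _ fun _ _ => rfl
    refine fun h0 => absurd (measure_mono_null hsub h0) ?_
    rw [Measure.prod_prod, Measure.pi_singleton]
    exact mul_ne_zero (hM _) (Finset.prod_ne_zero_iff.2 fun e _ => hν _ _)
  · have hd : Measurable fun (η : ∀ e : V × V, Ω e.1) (v : V) => η (v, v) :=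
      measurable_pi_iff.2 fun v => measurable_pi_apply (v, v)
    exact measurable_glue.comp (measurable_fst.prodMk (hd.comp measurable_snd))

end Extend

end SemiMarkovianModel

theorem exists_isProbabilityMeasure_singleton_ne_zero (α : Type u) [MeasurableSpace α]
    [Countable α] [Nonempty α] [MeasurableSingletonClass α] :
    ∃ μ : Measure α, IsProbabilityMeasure μ ∧ ∀ a, μ {a} ≠ 0 := by
  -- On a countable space, counting measure is absolutely continuous with respect to the probability
  -- measure `toFinite`, so no atom is lost.
  refine ⟨(Measure.count : Measure α).toFinite, inferInstance, fun a h => ?_⟩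
  have := absolutelyContinuous_toFinite (Measure.count : Measure α) h
  rw [Measure.count_singleton] at this
  exact one_ne_zero this

theorem marginal_singleton_ne_zero {V : Type u} [Finite V] {Ω : V → Type u}
    [∀ v, MeasurableSpace (Ω v)] [∀ v, Nonempty (Ω v)] [∀ v, MeasurableSingletonClass (Ω v)]
    (S : Set V) {P : Measure (∀ v, Ω v)} (hP : ∀ ω, P {ω} ≠ 0) (ω : ∀ v : S, Ω v) :
    marginal S P {ω} ≠ 0 := by
  rw [marginal, Measure.map_apply measurable_restrictTo (measurableSet_singleton ω)]
  refine fun h => hP (glue S ω fun v => Classical.arbitrary (Ω v)) (measure_mono_null ?_ h)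
  rintro _ rfl
  exact restrictTo_glue _ _

/-! ### Transporting functionals and identifiability -/

section Reduction

variable {V : Type u} [Finite V] {Ω : V → Type u} [∀ v, MeasurableSpace (Ω v)]
  [∀ v, Nonempty (Ω v)] [∀ v, Countable (Ω v)] [∀ v, MeasurableSingletonClass (Ω v)]
  {G : SMG V} {X Y S : Set V} {W : V}

/-- Left to right tests the functional on projections, right to left on extensions by fully
supported noise. -/
theorem identifies_induce_iff (hS : G.AttachedOnlyAt S W) (hX : X ⊆ S) (hY : Y ⊆ S)
    (F : Measure (∀ v : S, Ω v) → (∀ v : S, Ω v) → (∀ v : S, Ω v) → ℝ≥0∞) :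
    Identifies (G.induce S) (fun v : S => Ω v) (Subtype.val ⁻¹' X) (Subtype.val ⁻¹' Y) F ↔
      Identifies G Ω X Y
        (fun P x y => F (marginal S P) (restrictTo S x) (restrictTo S y)) := by
  constructor
  · intro h M hM x y
    rw [← M.effect_project hS hX hY x y, ← h (M.project hS), M.observed_project hS]
    rw [M.observed_project hS]
    exact marginal_singleton_ne_zero S hM
  · intro h M hM x y
    choose ν hν hpos using fun v => exists_isProbabilityMeasure_singleton_ne_zero (Ω v)
    have hx := restrictTo_glue x fun v => Classical.arbitrary (Ω v)
    have hy := restrictTo_glue y fun v => Classical.arbitrary (Ω v)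
    have := h (M.extend ν) (M.observed_extend_singleton_ne_zero ν hpos hM)
      (glue S x fun v => Classical.arbitrary (Ω v)) (glue S y fun v => Classical.arbitrary (Ω v))
    dsimp only at this
    rwa [M.marginal_observed_extend, M.effect_extend ν hY, hx, hy] at this

/-- A functional for `G` need not factor through the marginal on `S`, so `identifies_induce_iff`
alone does not give the converse. Instead it is applied to `P` completed by fixed independent noise,
which is the observed distribution of an extension. -/
theorem identifiable_induce_iff (hS : G.AttachedOnlyAt S W) (hX : X ⊆ S) (hY : Y ⊆ S) :
    Identifiable (G.induce S) (fun v : S => Ω v) (Subtype.val ⁻¹' X) (Subtype.val ⁻¹' Y) ↔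
      Identifiable G Ω X Y := by
  have := Fintype.ofFinite V
  constructor
  · rintro ⟨F, hF⟩
    exact ⟨_, (identifies_induce_iff hS hX hY F).1 hF⟩
  · rintro ⟨F, hF⟩
    choose ν hν hpos using fun v => exists_isProbabilityMeasure_singleton_ne_zero (Ω v)
    refine ⟨fun P x y => F ((P.prod (Measure.pi fun e : V × V => ν e.1)).map
        fun q => glue S q.1 fun v => q.2 (v, v))
      (glue S x fun v => Classical.arbitrary (Ω v))
      (glue S y fun v => Classical.arbitrary (Ω v)), fun M hM x y => ?_⟩
    have := hF (M.extend ν) (M.observed_extend_singleton_ne_zero ν hpos hM)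
      (glue S x fun v => Classical.arbitrary (Ω v)) (glue S y fun v => Classical.arbitrary (Ω v))
    rwa [M.effect_extend ν hY, restrictTo_glue, restrictTo_glue, M.observed_extend] at this

end Reduction

theorem mainTheorem5 {V : Type u} [Finite V] (Ω : V → Type u) [∀ v, MeasurableSpace (Ω v)]
    [∀ v, Nonempty (Ω v)] [∀ v, Countable (Ω v)] [∀ v, MeasurableSingletonClass (Ω v)]
    (G : SMG V) (X Y : Set V) (hXY : Disjoint X Y) (hG : G.An Y = Set.univ)
    (W : V) (R T S : Set V)
    (hR : R = (G.removeIn X).An {W} \ G.De X)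
    (hT : T = R \ (G.removeIn {W}).Co Rᶜ)
    (hS : S = Tᶜ) :
    Disjoint T X ∧
    (Y ⊆ G.De X → Disjoint T Y) ∧
    (X.Nonempty → Y.Subsingleton → Disjoint T Y) ∧
    (Disjoint T Y →
      (∀ M : SemiMarkovianModel G Ω,
        ∃ M' : SemiMarkovianModel (G.induce S) (fun v : S => Ω v),
          M'.observed = marginal S M.observed ∧
          ∀ x y : ∀ v, Ω v,
            M'.effect (Subtype.val ⁻¹' X) (Subtype.val ⁻¹' Y) (restrictTo S x) (restrictTo S y)
              = M.effect X Y x y) ∧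
      (∀ F : Measure (∀ v : S, Ω v) → (∀ v : S, Ω v) → (∀ v : S, Ω v) → ℝ≥0∞,
        Identifies (G.induce S) (fun v : S => Ω v) (Subtype.val ⁻¹' X) (Subtype.val ⁻¹' Y) F ↔
        Identifies G Ω X Y
          (fun P x y => F (marginal S P) (restrictTo S x) (restrictTo S y))) ∧
      (Identifiable (G.induce S) (fun v : S => Ω v) (Subtype.val ⁻¹' X) (Subtype.val ⁻¹' Y) ↔
        Identifiable G Ω X Y)) := by
  have hSCo : S = (G.removeIn {W}).Co Rᶜ := by
    subst hS hT
    ext v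
    simp only [Set.mem_compl_iff, Set.mem_sdiff, not_and, not_not]
    refine ⟨fun h => ?_, fun h _ => h⟩
    by_cases hv : v ∈ R
    · exact h hv
    · exact SMG.subset_Co _ _ hv
  have hTDe : Disjoint T (G.De X) := by
    subst hT hR
    exact Set.disjoint_left.2 fun v hv => hv.1.2
  have hTX : Disjoint T X := hTDe.mono_right (G.subset_De X)
  refine ⟨hTX, fun h => hTDe.mono_right h, fun ⟨x, hx⟩ hY => hTDe.mono_right ?_, fun hTY => ?_⟩
  -- Some element of `Y` descends from `x`, and it is the only element of `Y`.
  · obtain ⟨y, hy, hxy⟩ : x ∈ G.An Y := hG ▸ Set.mem_univ x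
    intro y' hy'
    exact hY hy hy' ▸ ⟨x, hx, hxy⟩
  · have hXS : X ⊆ S := hS ▸ hTX.subset_compl_left
    have hYS : Y ⊆ S := hS ▸ hTY.subset_compl_left
    have hatt : G.AttachedOnlyAt S W := by
      rw [hSCo] at hYS ⊢
      exact SMG.attachedOnlyAt_Co (SMG.mem_Co_removeIn_of_An_eq_univ hG hYS)
    exact ⟨fun M => ⟨M.project hatt, M.observed_project hatt, M.effect_project hatt hXS hYS⟩,
      identifies_induce_iff hatt hXS hYS, identifiable_induce_iff hatt hXS hYS⟩
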